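/- All rings are commutative with nonzero identity, and all ring extensions and algebra homomorphisms are unital. A ring $R$ is von Neumann regular if for every $a\in R$ there is $x\in R$ with $a=axa$. For an $R$-module $E$, the idealization $R(+)E$ is the ring with additive group $R\oplus E$ and multiplication $(r_1,e_1)(r_2,e_2)=(r_1r_2,\,r_1e_2+r_2e_1)$, regarded as an $R$-algebra via $r\mapsto(r,0)$. A ring extension $R\subset T$ is minimal if $R$ is a proper subring of $T$ and there is no ring $S$ with $R\subsetneq S\subsetneq T$. **Theorem.** Let $R\subset T$ be a minimal ring extension with $R$ von Neumann regular. Then either $T$ is von Neumann regular, or there is a maximal ideal $\mathfrak m$ of $R$ such that $T\cong R(+)R/\mathfrak m$ as $R$-algebras. -/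

import Mathlib

/-- A commutative ring `R` is von Neumann regular if every `a : R` has a quasi-inverse `x`,
that is, `a = a * x * a`. -/
def IsVonNeumannRegular (R : Type*) [CommRing R] : Prop :=
  ∀ a : R, ∃ x : R, a * x * a = a

/-- `R ⊂ T` is a minimal ring extension: the structure map `R → T` is injective, and its image is
a proper subring of `T` such that no subring of `T` lies strictly between the two. -/
structure IsMinimalRingExtension (R T : Type*) [CommRing R] [CommRing T] [Algebra R T] : Prop where
  injective : Function.Injective (algebraMap R T)
  range_ne_top : (algebraMap R T).range ≠ ⊤
  no_intermediate : ¬ ∃ S : Subring T, (algebraMap R T).range < S ∧ S < ⊤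

namespace IsVonNeumannRegular

variable {R : Type*} [CommRing R]

/-! By minimality any `t` outside `R` gives `T = R[t]`. If `T` is reduced, idempotents of `R` yield
quasi-inverses. If `x ≠ 0` has square zero, then `x ∉ R` as `R` is reduced, so `T = R ⊕ Rx` with `Rx
≅ R ⧸ ann x`; each nonzero `a • x` also generates `T`, which makes `ann x` maximal. -/

/-- A von Neumann regular ring is reduced. -/
theorem eq_zero_of_mul_self (hR : IsVonNeumannRegular R) {a : R} (ha : a * a = 0) : a = 0 := by
  obtain ⟨x, hx⟩ := hR a
  rw [← hx, mul_right_comm, ha, zero_mul]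

end IsVonNeumannRegular

/-- Every element of `R[t]` has the form `c + t * q` with `c : R` and `q ∈ R[t]`. -/
theorem Algebra.exists_add_mul_of_mem_adjoin_singleton {R T : Type*} [CommRing R] [CommRing T]
    [Algebra R T] {t y : T} (hy : y ∈ Algebra.adjoin R {t}) :
    ∃ c : R, ∃ q ∈ Algebra.adjoin R {t}, y = algebraMap R T c + t * q := by
  rw [Algebra.adjoin_singleton_eq_range_aeval] at hy ⊢
  obtain ⟨p, rfl⟩ := hy
  refine ⟨p.coeff 0, _, ⟨p.divX, rfl⟩, ?_⟩
  have hp := congrArg (Polynomial.aeval t) (Polynomial.X_mul_divX_add p)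
  rw [map_add, map_mul, Polynomial.aeval_X, Polynomial.aeval_C, add_comm] at hp
  exact hp.symm

/-- If `x ^ 2 = 0`, then `R[x] = R + R x`. -/
theorem Algebra.exists_add_smul_of_mem_adjoin_singleton {R T : Type*} [CommRing R] [CommRing T]
    [Algebra R T] {x y : T} (hx : x * x = 0) (hy : y ∈ Algebra.adjoin R {x}) :
    ∃ r s : R, y = algebraMap R T r + s • x := by
  obtain ⟨r, q, hq, rfl⟩ := Algebra.exists_add_mul_of_mem_adjoin_singleton hy
  obtain ⟨s, q', -, rfl⟩ := Algebra.exists_add_mul_of_mem_adjoin_singleton hq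
  refine ⟨r, s, ?_⟩
  rw [Algebra.smul_def]
  linear_combination q' * hx

namespace IsMinimalRingExtension

variable {R T : Type*} [CommRing R] [CommRing T] [Algebra R T]

/-- In a minimal extension, every element outside the base ring generates. -/
theorem mem_adjoin_singleton (h : IsMinimalRingExtension R T) {t : T}
    (ht : t ∉ (algebraMap R T).range) (y : T) : y ∈ Algebra.adjoin R {t} := by
  by_contra hy
  refine h.no_intermediate ⟨(Algebra.adjoin R {t}).toSubring, ?_, ?_⟩
  · refine lt_of_le_of_ne ?_ fun he => ht ?_
    · rintro _ ⟨r, rfl⟩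
      exact (Algebra.adjoin R {t}).algebraMap_mem r
    · rw [he]
      exact Algebra.self_mem_adjoin_singleton R t
  · refine lt_of_le_of_ne le_top fun he => hy ?_
    have : y ∈ (Algebra.adjoin R {t}).toSubring := he ▸ Subring.mem_top y
    exact this

/-- A reduced minimal extension of a von Neumann regular ring is von Neumann regular. -/
theorem isVonNeumannRegular (h : IsMinimalRingExtension R T) (hR : IsVonNeumannRegular R)
    (hT : ∀ x : T, x * x = 0 → x = 0) : IsVonNeumannRegular T := by
  intro t
  by_cases ht : t * t ∈ (algebraMap R T).range
  · obtain ⟨a, ha⟩ := ht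
    obtain ⟨x, hx⟩ := hR a
    replace hx := congrArg (algebraMap R T) hx
    simp only [map_mul, ha] at hx
    -- `a * x` is idempotent and `t * t = a`, so this element squares to zero.
    have key : t * (1 - t * t * algebraMap R T x) = 0 := by
      apply hT
      linear_combination -(1 - t * t * algebraMap R T x) * hx
    exact ⟨t * algebraMap R T x, by linear_combination -key⟩
  · obtain ⟨c, q, -, hc⟩ :=
      Algebra.exists_add_mul_of_mem_adjoin_singleton (h.mem_adjoin_singleton ht t)
    obtain ⟨y, hy⟩ := hR c
    replace hy := congrArg (algebraMap R T) hy
    simp only [map_mul] at hy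
    set c' := algebraMap R T c
    set y' := algebraMap R T y
    -- Here `t = c + t² q`. Split by the idempotent `e = c * y`: on `1 - e`, `t = t² q`; on `e`, `t
    -- * (1 - t * q) = c` is invertible with inverse `y * e`.
    refine ⟨q * (1 - c' * y') + (1 - t * q) * y' * (c' * y'), ?_⟩
    linear_combination (-(1 - c' * y') + t * y' * (c' * y')) * hc + (1 + t * y') * hy

/-- The base ring contains no nonzero element whose image has square zero. -/
theorem eq_zero_of_algebraMap_mul_self (h : IsMinimalRingExtension R T)
    (hR : IsVonNeumannRegular R) {r : R} (hr : algebraMap R T r * algebraMap R T r = 0) : r = 0 :=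
  hR.eq_zero_of_mul_self (h.injective (by rw [map_mul, hr, map_zero]))

/-- A nonzero element of a minimal extension with square zero has maximal annihilator. -/
theorem isMaximal_torsionOf (h : IsMinimalRingExtension R T) (hR : IsVonNeumannRegular R)
    {x : T} (hx : x * x = 0) (hx0 : x ≠ 0) : (Ideal.torsionOf R T x).IsMaximal := by
  rw [Ideal.isMaximal_iff]
  refine ⟨by simpa using hx0, fun J a hJ ha haJ => ?_⟩
  rw [Ideal.mem_torsionOf_iff] at ha
  have hax : (a • x) * (a • x) = 0 := by simp [hx]
  have hmem : a • x ∉ (algebraMap R T).range := by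
    rintro ⟨r, hr⟩
    rw [← hr] at hax ha
    exact ha (by rw [h.eq_zero_of_algebraMap_mul_self hR hax, map_zero])
  obtain ⟨r, s, hrs⟩ :=
    Algebra.exists_add_smul_of_mem_adjoin_singleton hax (h.mem_adjoin_singleton hmem x)
  have hr : algebraMap R T r = (1 - s * a) • x := by
    rw [sub_smul, one_smul, mul_smul, eq_sub_iff_add_eq, ← hrs]
  -- The image of `r` is a multiple of `x`, hence squares to zero.
  have hr0 : r = 0 := h.eq_zero_of_algebraMap_mul_self hR (by rw [hr]; simp [hx])
  have hJ' : 1 - s * a ∈ J := hJ (by rw [Ideal.mem_torsionOf_iff, ← hr, hr0, map_zero])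
  simpa using J.add_mem hJ' (J.mul_mem_left s haJ)

/-- A minimal extension of a von Neumann regular ring containing a nonzero `x` with `x ^ 2 = 0` is
the idealization of `R ⧸ ann x`. -/
theorem nonempty_algEquiv_trivSqZeroExt (h : IsMinimalRingExtension R T)
    (hR : IsVonNeumannRegular R) {x : T} (hx : x * x = 0) (hx0 : x ≠ 0) :
    Nonempty (T ≃ₐ[R] TrivSqZeroExt R (R ⧸ Ideal.torsionOf R T x)) := by
  have hmem : x ∉ (algebraMap R T).range := by
    rintro ⟨r, rfl⟩
    exact hx0 (by rw [h.eq_zero_of_algebraMap_mul_self hR hx, map_zero])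
  let g : (R ⧸ Ideal.torsionOf R T x) →ₗ[R] T :=
    (Ideal.torsionOf R T x).liftQ (LinearMap.toSpanSingleton R T x) le_rfl
  have hg : ∀ s : R, g (Submodule.Quotient.mk s) = s • x := fun s => rfl
  have hgg : ∀ u v, g u * g v = 0 := by
    intro u v
    obtain ⟨a, rfl⟩ := Submodule.Quotient.mk_surjective _ u
    obtain ⟨b, rfl⟩ := Submodule.Quotient.mk_surjective _ v
    rw [hg, hg, smul_mul_smul_comm, hx, smul_zero]
  let f := TrivSqZeroExt.liftEquivOfComm ⟨g, hgg⟩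
  have hf : ∀ z, f z = algebraMap R T z.fst + g z.snd := fun z => rfl
  refine ⟨(AlgEquiv.ofBijective f ⟨?_, fun y => ?_⟩).symm⟩
  · rw [injective_iff_map_eq_zero]
    intro z hz
    rw [hf] at hz
    have h1 : z.fst = 0 :=
      h.eq_zero_of_algebraMap_mul_self hR (by rw [eq_neg_of_add_eq_zero_left hz, neg_mul_neg, hgg])
    rw [h1, map_zero, zero_add] at hz
    obtain ⟨s, hs⟩ := Submodule.Quotient.mk_surjective _ z.snd
    rw [← hs, hg] at hz
    refine TrivSqZeroExt.ext h1 ?_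
    rw [← hs]
    exact (Submodule.Quotient.mk_eq_zero _).2 ((Ideal.mem_torsionOf_iff _ _).2 hz)
  · obtain ⟨r, s, rfl⟩ :=
      Algebra.exists_add_smul_of_mem_adjoin_singleton hx (h.mem_adjoin_singleton hmem y)
    exact ⟨(r, Submodule.Quotient.mk s), rfl⟩

end IsMinimalRingExtension

theorem theorem2p1 {R T : Type*} [CommRing R] [CommRing T] [Algebra R T]
    (hRT : IsMinimalRingExtension R T) (hR : IsVonNeumannRegular R) :
    IsVonNeumannRegular T ∨
      ∃ m : Ideal R, m.IsMaximal ∧ Nonempty (T ≃ₐ[R] TrivSqZeroExt R (R ⧸ m)) := by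
  by_cases hT : ∀ x : T, x * x = 0 → x = 0
  · exact Or.inl (hRT.isVonNeumannRegular hR hT)
  · push Not at hT
    obtain ⟨x, hx, hx0⟩ := hT
    exact Or.inr ⟨_, hRT.isMaximal_torsionOf hR hx hx0,
      hRT.nonempty_algEquiv_trivSqZeroExt hR hx hx0⟩
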